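/- Let $\Gamma=\{\lambda\in\mathbb{C}\setminus\{0,1\} : |\lambda|\le 1,\ |1-\lambda|\le 1\}$. For $\lambda\in\Gamma$ let $$\omega_1(\lambda)=\int_1^{\infty}\frac{dX}{\sqrt{X(X-1)(X-\lambda)}},\qquad \omega_2(\lambda)=\int_0^{-\infty}\frac{dX}{\sqrt{X(X-1)(X-\lambda)}}$$ be the periods of the Legendre curve $Y^2=X(X-1)(X-\lambda)$ with respect to $\frac{dX}{2Y}$, where both integrals are taken along the real line; for $\omega_1$ the square root is the one on the plane cut along the negative real axis with $\sqrt{1}=1$, and for $\omega_2$ it is the one on the plane cut along the positive real axis with $\sqrt{-1}=i$. Let $$F(\lambda)=\sum_{n=0}^{\infty}\frac{\left(\frac12\right)_n^2}{n!^2}\lambda^n\quad(|\lambda|<1),\qquad \left(\tfrac12\right)_n=\tfrac12\left(\tfrac12+1\right)\cdots\left(\tfrac12+n-1\right),$$ and let $A(\lambda)=\omega_1\overline{\omega_2}-\omega_2\overline{\omega_1}$. Then $\omega_1(\lambda)=\pi F(\lambda)$ and $\omega_2(\lambda)=i\pi F(1-\lambda)$ for all $\lambda$ in the interior of $\Gamma$,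 and for every $\lambda\in\Gamma$ $$|A(\lambda)|\ \ge\ \max\left\{\frac{4}{\pi}\Bigl(\log\max\{|\lambda|^{-1},|1-\lambda|^{-1}\}-\log 11\Bigr),\ 2\sqrt{3}\right\}.$$ -/

import Mathlib

noncomputable section

namespace Legendre

/-- The set of complex `l`, different from `0` and `1`, with `|l| ≤ 1` and `|1 - l| ≤ 1`. -/
def Gam : Set ℂ := {l : ℂ | l ≠ 0 ∧ l ≠ 1 ∧ ‖l‖ ≤ 1 ∧ ‖1 - l‖ ≤ 1}

/-- The classical hypergeometric function `F(1/2, 1/2, 1; l)`, the sum of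
`((1/2)_n)² / (n!)² * l ^ n` for `|l| < 1`. -/
def F (l : ℂ) : ℂ := ordinaryHypergeometric (1 / 2 : ℂ) (1 / 2 : ℂ) (1 : ℂ) l

/-- The square root on the plane cut along the negative real axis, with value `1` at `1`. -/
def sqrtCutNeg (w : ℂ) : ℂ := w ^ (1 / 2 : ℂ)

/-- The square root on the plane cut along the positive real axis, with value `I` at `-1`. -/
def sqrtCutPos (w : ℂ) : ℂ := Complex.I * (-w) ^ (1 / 2 : ℂ)

/-- The cubic `X (X - 1) (X - l)` of the Legendre curve `Y² = X (X - 1) (X - l)`. -/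
def cubic (l X : ℂ) : ℂ := X * (X - 1) * (X - l)

/-- The period `ω₁`: the integral from `1` to `∞`, along the real line, of
`dX / √(X (X - 1) (X - l))`. -/
def omega1 (l : ℂ) : ℂ := ∫ X : ℝ in Set.Ioi 1, 1 / sqrtCutNeg (cubic l (X : ℂ))

/-- The period `ω₂`: the integral from `0` to `-∞`, along the real line, of
`dX / √(X (X - 1) (X - l))`; the direction of integration gives the sign. -/
def omega2 (l : ℂ) : ℂ := -∫ X : ℝ in Set.Iio 0, 1 / sqrtCutPos (cubic l (X : ℂ))

/-- The area term `A = ω₁ ω̄₂ - ω₂ ω̄₁`. -/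
def area (l : ℂ) : ℂ :=
  omega1 l * (starRingEnd ℂ) (omega2 l) - omega2 l * (starRingEnd ℂ) (omega1 l)

end Legendre

end

/-!
The proof rests on one factorization. For `X > 1` the cubic is `X² (X - 1) (1 - l / X)`, with positive
first factor, so `ω₁(l)` is the integral over `(1, ∞)` of `(1 - l / X) ^ (-1/2)` against the positive
weight `1 / (X √(X - 1))`, whose total mass is `π` (`omega1_eq`, `integral_weight`). The substitution
`X ↦ 1 - X` gives `ω₂(l) = i ω₁(1 - l)` (`omega2_eq`), so only `ω₁` has to be studied.

*Hypergeometric form.* For `‖l‖ < 1`, expand `(1 - l / X) ^ (-1/2)` in its binomial series. The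
moments of the weight are `∫ X ^ (-n) = π (1/2)_n / n!` (`integral_weight_div_pow`), by a recursion
that comes from differentiating `√(X - 1) / X ^ (n + 1)`. Integrating term by term gives `π F(l)`
(`omega1_eq_pi_mul_F`).

*Area bound.* From `ω₂(l) = i ω₁(1 - l)` one gets `|A| = 2 |Re (ω₁(l) * conj (ω₁(1 - l)))|`. Let `α`
and `β` be the angles at `0` and `1` of the triangle with vertices `0`, `1`, `l`. As `X` runs over
`(1, ∞)`, the argument of `X - l` is at most `β` in modulus, so `ω₁(l)` lies in the sector
`|arg| ≤ β / 2` (`abs_im_omega1_le`), and likewise `ω₁(1 - l)` in `|arg| ≤ α / 2`. On the lens the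
side `[0, 1]` is the longest, and `tan (α / 2) * tan (β / 2) ≤ 1 / 3` (`three_mul_im_sq_le`). Hence
`|A| ≥ (4 / 3) Re ω₁(l) Re ω₁(1 - l)` (`mul_re_le_norm_area`).

The two real parts are bounded below by comparing integrands: `‖1 - l / X‖ ≤ 1` and
`|arg (1 - l / X)| ≤ π / 2` give `Re ω₁(l) ≥ π / √2`, and the part of the integral near `X = 1` gives
`Re ω₁(l) ≥ (1 / 2) log ‖1 - l‖⁻¹`. Two factors `π / √2` yield `|A| ≥ 2 π² / 3 > 2 √3`; one factor
`π / √2 ≥ 2` and one logarithmic factor yield `|A| ≥ (4 / 3) log (max ‖l‖⁻¹ ‖1 - l‖⁻¹)`.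
-/

namespace Legendre

open MeasureTheory Set Filter Topology

/-! ### The principal square root -/

/-- The principal square root commutes with multiplication by a positive real number. -/
lemma ofReal_mul_cpow_half {r : ℝ} (hr : 0 < r) (z : ℂ) :
    ((r : ℂ) * z) ^ (1 / 2 : ℂ) = (√r : ℂ) * z ^ (1 / 2 : ℂ) := by
  rcases eq_or_ne z 0 with rfl | hz
  · simp
  have hr' : (r : ℂ) ≠ 0 := by exact_mod_cast hr.ne'
  have hs : (√r : ℂ) = (r : ℂ) ^ (1 / 2 : ℂ) := by
    rw [Real.sqrt_eq_rpow, Complex.ofReal_cpow hr.le]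
    norm_num
  rw [hs, Complex.cpow_def_of_ne_zero (mul_ne_zero hr' hz), Complex.cpow_def_of_ne_zero hr',
    Complex.cpow_def_of_ne_zero hz, Complex.log_ofReal_mul hr hz, Complex.ofReal_log hr.le,
    add_mul, Complex.exp_add]

lemma cpow_half_mul_self (z : ℂ) : z ^ (1 / 2 : ℂ) * z ^ (1 / 2 : ℂ) = z := by
  rw [← sq, ← Complex.cpow_nat_mul]
  norm_num

lemma cpow_half_re_pos {z : ℂ} (hz : 0 < z.re) : 0 < (z ^ (1 / 2 : ℂ)).re := by
  have h0 : z ≠ 0 := by rintro rfl; simp at hz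
  have ha := Complex.abs_arg_lt_pi_div_two_iff.mpr (Or.inl hz)
  rw [abs_lt] at ha
  rw [Complex.cpow_def_of_ne_zero h0, Complex.exp_re]
  have him : (Complex.log z * (1 / 2)).im = z.arg / 2 := by
    rw [show (1 / 2 : ℂ) = ((1 / 2 : ℝ) : ℂ) by norm_num, Complex.im_mul_ofReal, Complex.log_im]
    ring
  rw [him]
  refine mul_pos (Real.exp_pos _) (Real.cos_pos_of_mem_Ioo ⟨?_, ?_⟩) <;>
    linarith [Real.pi_pos]

lemma norm_cpow_half (z : ℂ) : ‖z ^ (1 / 2 : ℂ)‖ = √‖z‖ := by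
  rw [eq_comm, Real.sqrt_eq_iff_mul_self_eq (norm_nonneg _) (norm_nonneg _), ← norm_mul,
    cpow_half_mul_self]

lemma norm_inv_cpow_half_le {z : ℂ} {c : ℝ} (hc : 0 < c) (hz : c ≤ z.re) :
    ‖1 / z ^ (1 / 2 : ℂ)‖ ≤ 1 / √c := by
  rw [norm_div, norm_one, norm_cpow_half]
  exact one_div_le_one_div_of_le (Real.sqrt_pos.mpr hc)
    (Real.sqrt_le_sqrt (hz.trans (Complex.re_le_norm z)))

/-- The argument of a square root in the right half-plane is at most `π / 4`, so its inverse
has real part at least `1 / √2` times its modulus. -/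
lemma le_re_inv_cpow_half {z : ℂ} (hz : 0 < z.re) :
    1 / √(2 * ‖z‖) ≤ (1 / z ^ (1 / 2 : ℂ)).re := by
  have hre := cpow_half_re_pos hz
  have hmul := cpow_half_mul_self z
  have hn : ‖z ^ (1 / 2 : ℂ)‖ * ‖z ^ (1 / 2 : ℂ)‖ = ‖z‖ := by rw [← norm_mul, hmul]
  set s := z ^ (1 / 2 : ℂ) with hs
  have h1 : ‖z‖ = Complex.normSq s := by rw [Complex.normSq_eq_norm_sq, sq, hn]
  have h2 : s.re * s.re - s.im * s.im = z.re := by rw [← hmul, Complex.mul_re]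
  have hN : 0 < Complex.normSq s := by rw [Complex.normSq_apply]; nlinarith
  have hle : Complex.normSq s ≤ 2 * s.re ^ 2 := by rw [Complex.normSq_apply]; nlinarith
  rw [one_div, one_div, Complex.inv_re, h1, le_div_iff₀ hN,
    inv_mul_le_iff₀ (Real.sqrt_pos.mpr (by positivity))]
  refine le_of_sq_le_sq ?_ (by positivity)
  rw [mul_pow, Real.sq_sqrt (by positivity)]
  nlinarith

/-- Half-angle formula: `|tan (arg z / 2)| = |Im z| / (‖z‖ + Re z)`. -/
lemma abs_im_inv_cpow_half_mul {z : ℂ} (hz : 0 < z.re) :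
    |(1 / z ^ (1 / 2 : ℂ)).im| * (‖z‖ + z.re) = |z.im| * (1 / z ^ (1 / 2 : ℂ)).re := by
  have hre := cpow_half_re_pos hz
  have hmul := cpow_half_mul_self z
  have hn : ‖z ^ (1 / 2 : ℂ)‖ * ‖z ^ (1 / 2 : ℂ)‖ = ‖z‖ := by rw [← norm_mul, hmul]
  set s := z ^ (1 / 2 : ℂ) with hs
  have h1 : ‖z‖ = Complex.normSq s := by rw [Complex.normSq_eq_norm_sq, sq, hn]
  have h2 : s.re * s.re - s.im * s.im = z.re := by rw [← hmul, Complex.mul_re]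
  have h3 : 2 * s.re * s.im = z.im := by rw [← hmul, Complex.mul_im]; ring
  have hN : 0 < Complex.normSq s := by rw [Complex.normSq_apply]; nlinarith
  rw [one_div, Complex.inv_re, Complex.inv_im, ← h2, ← h3, h1, abs_div, abs_neg, abs_mul,
    abs_of_pos hN, abs_of_pos (by linarith : 0 < 2 * s.re)]
  field_simp
  rw [Complex.normSq_apply]
  ring

/-! ### Wallis integrals and the hypergeometric series -/

/-- The coefficient `(1/2)_n / n!` of the binomial series of `(1 - z) ^ (-1/2)`. -/
noncomputable def halfCoeff (n : ℕ) : ℝ := (ascPochhammer ℝ n).eval (1 / 2) / n.factorial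

lemma halfCoeff_zero : halfCoeff 0 = 1 := by simp [halfCoeff]

lemma halfCoeff_succ (n : ℕ) : (n + 1) * halfCoeff (n + 1) = (n + 1 / 2) * halfCoeff n := by
  have : (n.factorial : ℝ) ≠ 0 := by positivity
  simp only [halfCoeff, ascPochhammer_succ_eval, Nat.factorial_succ]
  push_cast
  field_simp
  ring

lemma halfCoeff_pos (n : ℕ) : 0 < halfCoeff n := by
  induction n with
  | zero => simp [halfCoeff_zero]
  | succ n ih =>
    have h := halfCoeff_succ n
    have : 0 < ((n : ℝ) + 1 / 2) * halfCoeff n := by positivity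
    rw [← h] at this
    exact pos_of_mul_pos_right this (by positivity)

lemma halfCoeff_le_one (n : ℕ) : halfCoeff n ≤ 1 := by
  induction n with
  | zero => simp [halfCoeff_zero]
  | succ n ih =>
    have h := halfCoeff_succ n
    have hp := halfCoeff_pos n
    have : (0 : ℝ) < n + 1 := by positivity
    by_contra! hlt
    nlinarith

lemma ofReal_halfCoeff (n : ℕ) :
    (halfCoeff n : ℂ) = (ascPochhammer ℂ n).eval (1 / 2) / n.factorial := by
  have h : (((ascPochhammer ℝ n).eval (1 / 2) : ℝ) : ℂ) = (ascPochhammer ℂ n).eval (1 / 2) := by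
    induction n with
    | zero => simp
    | succ n ih =>
      rw [ascPochhammer_succ_eval, ascPochhammer_succ_eval, ← ih]
      push_cast
      rfl
  rw [halfCoeff, Complex.ofReal_div, h, Complex.ofReal_natCast]

lemma hasSum_inv_cpow_half {z : ℂ} (hz : ‖z‖ < 1) :
    HasSum (fun n ↦ (halfCoeff n : ℂ) * z ^ n) (1 / (1 - z) ^ (1 / 2 : ℂ)) := by
  have h := (Complex.one_div_one_sub_cpow_hasFPowerSeriesOnBall_zero (1 / 2)).hasSum
    (y := z) (by simpa [Metric.mem_eball, edist_zero_right, ← ofReal_norm] using hz)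
  rw [zero_add] at h
  convert! h using 2 with n
  rw [FormalMultilinearSeries.ofScalars_apply_eq, Ring.choose_eq_smul,
    Polynomial.descPochhammer_smeval_eq_ascPochhammer, Polynomial.ascPochhammer_smeval_cast,
    Polynomial.ascPochhammer_smeval_eq_eval,
    ofReal_halfCoeff]
  rw [show (1 / 2 + n - 1 - n + 1 : ℂ) = 1 / 2 by ring, smul_eq_mul, smul_eq_mul, div_eq_inv_mul]

/-- The weight `1 / (X √(X - 1))` on `(1, ∞)`, of total mass `π`. -/
noncomputable def weight (X : ℝ) : ℝ := 1 / (X * √(X - 1))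

lemma weight_pos {X : ℝ} (hX : 1 < X) : 0 < weight X := by
  have : 0 < √(X - 1) := Real.sqrt_pos.mpr (by linarith)
  unfold weight
  positivity

lemma hasDerivAt_two_arctan_sqrt {X : ℝ} (hX : 1 < X) :
    HasDerivAt (fun X ↦ 2 * Real.arctan √(X - 1)) (weight X) X := by
  have h1 : 0 < X - 1 := by linarith
  have h := ((((hasDerivAt_id X).sub_const 1).sqrt h1.ne').arctan).const_mul 2
  refine h.congr_deriv ?_
  have h2 : 0 < √(X - 1) := Real.sqrt_pos.mpr h1
  simp only [id, weight, Real.sq_sqrt h1.le]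
  field_simp
  ring

lemma tendsto_two_arctan_sqrt :
    Tendsto (fun X : ℝ ↦ 2 * Real.arctan √(X - 1)) atTop (𝓝 Real.pi) := by
  have h : Tendsto (fun X : ℝ ↦ √(X - 1)) atTop atTop :=
    Real.tendsto_sqrt_atTop.comp (tendsto_atTop_add_const_right _ _ tendsto_id)
  have h2 := ((Real.tendsto_arctan_atTop.mono_right nhdsWithin_le_nhds).comp h).const_mul 2
  simpa [Function.comp_def, mul_div_cancel₀] using h2

lemma integrableOn_weight : IntegrableOn weight (Ioi 1) :=
  integrableOn_Ioi_deriv_of_nonneg (by fun_prop)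
    (fun _ hX ↦ hasDerivAt_two_arctan_sqrt hX) (fun _ hX ↦ (weight_pos hX).le)
    tendsto_two_arctan_sqrt

lemma integral_weight : ∫ X in Ioi 1, weight X = Real.pi := by
  rw [integral_Ioi_of_hasDerivAt_of_tendsto (by fun_prop)
    (fun _ hX ↦ hasDerivAt_two_arctan_sqrt hX) integrableOn_weight tendsto_two_arctan_sqrt]
  simp

lemma measurable_weight : Measurable weight := by
  unfold weight
  fun_prop

lemma integrableOn_weight_div_pow (n : ℕ) : IntegrableOn (fun X ↦ weight X / X ^ n) (Ioi 1) := by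
  refine integrableOn_weight.mono'
    (measurable_weight.div (measurable_id.pow_const n)).aestronglyMeasurable ?_
  filter_upwards [ae_restrict_mem measurableSet_Ioi] with X hX
  have hX' : (1 : ℝ) < X := hX
  rw [Real.norm_of_nonneg (div_nonneg (weight_pos hX').le (by positivity))]
  exact div_le_self (weight_pos hX').le (one_le_pow₀ hX'.le)

/-- The recursion for the Wallis integrals comes from integrating the derivative of
`√(X - 1) / X ^ (n + 1)`, which vanishes at both ends. -/
lemma integral_weight_div_pow_succ (n : ℕ) :
    (n + 1) * ∫ X in Ioi 1, weight X / X ^ (n + 1)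
      = (n + 1 / 2) * ∫ X in Ioi 1, weight X / X ^ n := by
  have hd : ∀ X ∈ Ioi (1 : ℝ), HasDerivAt (fun X : ℝ ↦ √(X - 1) / X ^ (n + 1))
      ((n + 1) * (weight X / X ^ (n + 1)) - (n + 1 / 2) * (weight X / X ^ n)) X := by
    intro X hX
    have hX : 1 < X := hX
    have h1 : 0 < X - 1 := by linarith
    have h0 : 0 < X := by linarith
    have h2 : 0 < √(X - 1) := Real.sqrt_pos.mpr h1
    have h3 : √(X - 1) ^ 2 = X - 1 := Real.sq_sqrt h1.le
    have h := (((hasDerivAt_id X).sub_const 1).sqrt h1.ne').div (hasDerivAt_pow (n + 1) X)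
      (by positivity)
    refine h.congr_deriv ?_
    simp only [id, weight]
    push_cast
    field_simp
    rw [h3]
    ring
  have hi : IntegrableOn (fun X ↦ (n + 1 : ℝ) * (weight X / X ^ (n + 1))
      - (n + 1 / 2) * (weight X / X ^ n)) (Ioi 1) :=
    ((integrableOn_weight_div_pow _).const_mul _).sub ((integrableOn_weight_div_pow _).const_mul _)
  have hc : ContinuousWithinAt (fun X : ℝ ↦ √(X - 1) / X ^ (n + 1)) (Ici 1) 1 := by
    refine ContinuousAt.continuousWithinAt (ContinuousAt.div (by fun_prop) (by fun_prop) ?_)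
    simp
  have ht : Tendsto (fun X : ℝ ↦ √(X - 1) / X ^ (n + 1)) atTop (𝓝 0) := by
    have hlim : Tendsto (fun X : ℝ ↦ 1 / √X) atTop (𝓝 0) := by
      simpa [Pi.inv_def] using Real.tendsto_sqrt_atTop.inv_tendsto_atTop
    refine tendsto_of_tendsto_of_tendsto_of_le_of_le' tendsto_const_nhds hlim ?_ ?_
    · filter_upwards [eventually_gt_atTop 1] with X hX
      have : 0 < X := by linarith
      positivity
    · filter_upwards [eventually_gt_atTop 1] with X hX
      have h0 : 0 < X := by linarith
      have hs : √X * √X = X := Real.mul_self_sqrt h0.le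
      rw [div_le_div_iff₀ (by positivity) (Real.sqrt_pos.mpr h0)]
      calc √(X - 1) * √X ≤ √X * √X := by gcongr; linarith
        _ = X ^ 1 := by rw [hs, pow_one]
        _ ≤ 1 * X ^ (n + 1) := by rw [one_mul]; exact pow_le_pow_right₀ hX.le (by omega)
  have h := integral_Ioi_of_hasDerivAt_of_tendsto hc hd hi ht
  rw [integral_sub ((integrableOn_weight_div_pow _).const_mul _)
    ((integrableOn_weight_div_pow _).const_mul _), integral_const_mul, integral_const_mul] at h
  simp only [sub_self, Real.sqrt_zero, zero_div] at h
  linarith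

lemma integral_weight_div_pow (n : ℕ) :
    ∫ X in Ioi 1, weight X / X ^ n = Real.pi * halfCoeff n := by
  induction n with
  | zero => simp [integral_weight, halfCoeff_zero]
  | succ n ih =>
    have h := integral_weight_div_pow_succ n
    rw [ih] at h
    have hn : (n + 1 : ℝ) ≠ 0 := by positivity
    apply mul_left_cancel₀ hn
    rw [h, mul_left_comm, mul_left_comm (n + 1 : ℝ), halfCoeff_succ]

/-! ### The periods -/

/-- On `(1, ∞)` the cubic is `X² (X - 1)` times `1 - l / X`. -/
lemma one_div_sqrtCutNeg_cubic (l : ℂ) {X : ℝ} (hX : 1 < X) :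
    1 / sqrtCutNeg (cubic l X) = (weight X : ℂ) * (1 / (1 - l / X) ^ (1 / 2 : ℂ)) := by
  have h0 : 0 < X := by linarith
  have h1 : 0 < X - 1 := by linarith
  have hX0 : (X : ℂ) ≠ 0 := by exact_mod_cast h0.ne'
  have hc : cubic l X = ((X ^ 2 * (X - 1) : ℝ) : ℂ) * (1 - l / X) := by
    unfold cubic
    push_cast
    field_simp
  rw [sqrtCutNeg, hc, ofReal_mul_cpow_half (by positivity), Real.sqrt_mul (by positivity),
    Real.sqrt_sq h0.le, weight]
  push_cast
  rw [one_div_mul_one_div]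

lemma omega1_eq (l : ℂ) :
    omega1 l = ∫ X : ℝ in Ioi 1, (weight X : ℂ) * (1 / (1 - l / X) ^ (1 / 2 : ℂ)) :=
  setIntegral_congr_fun measurableSet_Ioi fun _ hX ↦ one_div_sqrtCutNeg_cubic l hX

/-- The substitution `X ↦ 1 - X` turns `ω₂` into `ω₁` at the reflected parameter. -/
lemma omega2_eq (l : ℂ) : omega2 l = Complex.I * omega1 (1 - l) := by
  have hmp := Measure.measurePreserving_sub_left (volume : Measure ℝ) 1
  have hemb : MeasurableEmbedding (fun X : ℝ ↦ 1 - X) :=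
    (MeasurableEquiv.subLeft (1 : ℝ)).measurableEmbedding
  have h := hmp.setIntegral_preimage_emb hemb
    (fun X : ℝ ↦ 1 / sqrtCutPos (cubic l (X : ℂ))) (Iio 0)
  have hpre : (fun X : ℝ ↦ 1 - X) ⁻¹' Iio 0 = Ioi 1 := by ext; simp
  rw [omega2, ← h, hpre, omega1, ← integral_neg, ← integral_const_mul]
  refine setIntegral_congr_fun measurableSet_Ioi fun X _ ↦ ?_
  have hc : -cubic l ((1 - X : ℝ) : ℂ) = cubic (1 - l) X := by
    unfold cubic
    push_cast
    ring
  simp only [sqrtCutPos, sqrtCutNeg, hc]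
  rw [← one_div_mul_one_div, Complex.div_I]
  ring

/-- Expand `(1 - l / X) ^ (-1/2)` in its binomial series and integrate term by term. -/
theorem omega1_eq_pi_mul_F {l : ℂ} (hl : ‖l‖ < 1) : omega1 l = (Real.pi : ℂ) * F l := by
  let f : ℕ → ℝ → ℂ := fun n X ↦ ((weight X / X ^ n : ℝ) : ℂ) * ((halfCoeff n : ℂ) * l ^ n)
  have hint : ∀ n, ∫ X in Ioi 1, f n X =
      ((Real.pi * halfCoeff n : ℝ) : ℂ) * (halfCoeff n * l ^ n) := by
    intro n
    rw [integral_mul_const, integral_complex_ofReal, integral_weight_div_pow]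
  have hnorm : ∀ n, ∫ X in Ioi 1, ‖f n X‖ = Real.pi * halfCoeff n * (halfCoeff n * ‖l‖ ^ n) := by
    intro n
    rw [← integral_weight_div_pow, ← integral_mul_const]
    refine setIntegral_congr_fun measurableSet_Ioi fun X hX ↦ ?_
    have hX : 1 < X := hX
    have h0 : 0 ≤ weight X / X ^ n := div_nonneg (weight_pos hX).le (by positivity)
    simp only [f, norm_mul, norm_pow, Complex.norm_real, Real.norm_of_nonneg h0,
      Real.norm_of_nonneg (halfCoeff_pos n).le]
  have hfi : ∀ n, Integrable (f n) (volume.restrict (Ioi 1)) := fun n ↦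
    ((integrableOn_weight_div_pow n).ofReal).mul_const _
  have hsum : Summable fun n ↦ ∫ X in Ioi 1, ‖f n X‖ := by
    simp only [hnorm]
    refine Summable.of_nonneg_of_le (fun n ↦ ?_) (fun n ↦ ?_)
      ((summable_geometric_of_lt_one (norm_nonneg l) hl).mul_left Real.pi)
    · have := halfCoeff_pos n
      positivity
    · have h1 := halfCoeff_pos n
      have h2 := halfCoeff_le_one n
      have hp := Real.pi_pos
      calc Real.pi * halfCoeff n * (halfCoeff n * ‖l‖ ^ n)
          ≤ Real.pi * 1 * (1 * ‖l‖ ^ n) := by gcongr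
        _ = Real.pi * ‖l‖ ^ n := by ring
  have hmain := hasSum_integral_of_summable_integral_norm hfi hsum
  have hval : ∫ X in Ioi 1, ∑' n, f n X = omega1 l := by
    rw [omega1_eq]
    refine setIntegral_congr_fun measurableSet_Ioi fun X hX ↦ ?_
    have hX : 1 < X := hX
    have hz : ‖l / X‖ < 1 := by
      rw [norm_div, Complex.norm_real, Real.norm_of_nonneg (by linarith),
        div_lt_one (by linarith)]
      linarith
    have hs := (hasSum_inv_cpow_half hz).mul_left (weight X : ℂ)
    rw [← hs.tsum_eq]
    refine tsum_congr fun n ↦ ?_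
    simp only [f]
    push_cast
    rw [div_pow]
    ring
  rw [hval] at hmain
  rw [← hmain.tsum_eq, F, ordinaryHypergeometric_eq_tsum, ← tsum_mul_left]
  refine tsum_congr fun n ↦ ?_
  rw [hint, ascPochhammer_eval_one]
  push_cast
  rw [ofReal_halfCoeff, smul_eq_mul]
  ring

/-! ### Lower bounds on the lens -/

lemma one_sub_mem_Gam {l : ℂ} (hl : l ∈ Gam) : 1 - l ∈ Gam := by
  obtain ⟨h0, h1, h2, h3⟩ := hl
  exact ⟨sub_ne_zero.mpr h1.symm, by simpa using h0, h3, by simpa using h2⟩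

lemma normSq_le_two_mul_re {l : ℂ} (hl : l ∈ Gam) : ‖l‖ ^ 2 ≤ 2 * l.re := by
  obtain ⟨-, -, -, h⟩ := hl
  have h2 : ‖1 - l‖ ^ 2 ≤ 1 := pow_le_one₀ (norm_nonneg _) h
  rw [Complex.sq_norm, Complex.normSq_apply] at h2 ⊢
  simp only [Complex.sub_re, Complex.one_re, Complex.sub_im, Complex.one_im] at h2
  linarith

lemma re_pos_of_mem_Gam {l : ℂ} (hl : l ∈ Gam) : 0 < l.re := by
  have h := normSq_le_two_mul_re hl
  have : 0 < ‖l‖ := norm_pos_iff.mpr hl.1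
  have : 0 < ‖l‖ ^ 2 := by positivity
  linarith

lemma re_lt_one_of_mem_Gam {l : ℂ} (hl : l ∈ Gam) : l.re < 1 := by
  simpa using re_pos_of_mem_Gam (one_sub_mem_Gam hl)

lemma re_one_sub_div (l : ℂ) (X : ℝ) : (1 - l / X).re = 1 - l.re / X := by
  simp [Complex.div_ofReal_re]

lemma im_one_sub_div (l : ℂ) (X : ℝ) : (1 - l / X).im = -(l.im / X) := by
  simp [Complex.div_ofReal_im]

lemma norm_one_sub_div (l : ℂ) {X : ℝ} (hX : 0 < X) : ‖1 - l / X‖ = ‖X - l‖ / X := by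
  have hX0 : (X : ℂ) ≠ 0 := by exact_mod_cast hX.ne'
  rw [one_sub_div hX0, norm_div, Complex.norm_real, Real.norm_of_nonneg hX.le]

lemma one_sub_re_le {l : ℂ} (hl : l ∈ Gam) {X : ℝ} (hX : 1 < X) :
    1 - l.re ≤ (1 - l / X).re := by
  rw [re_one_sub_div]
  have := div_le_self (re_pos_of_mem_Gam hl).le hX.le
  linarith

lemma re_one_sub_div_pos {l : ℂ} (hl : l ∈ Gam) {X : ℝ} (hX : 1 < X) : 0 < (1 - l / X).re :=
  (sub_pos.mpr (re_lt_one_of_mem_Gam hl)).trans_le (one_sub_re_le hl hX)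

lemma integrableOn_omega1 {l : ℂ} (hl : l ∈ Gam) :
    IntegrableOn (fun X : ℝ ↦ (weight X : ℂ) * (1 / (1 - l / X) ^ (1 / 2 : ℂ))) (Ioi 1) := by
  refine (integrableOn_weight.mul_const (1 / √(1 - l.re))).mono' ?_ ?_
  · have := measurable_weight
    exact Measurable.aestronglyMeasurable (by fun_prop)
  · filter_upwards [ae_restrict_mem measurableSet_Ioi] with X hX
    rw [norm_mul, Complex.norm_real, Real.norm_of_nonneg (weight_pos hX).le]
    exact mul_le_mul_of_nonneg_left (norm_inv_cpow_half_le
      (sub_pos.mpr (re_lt_one_of_mem_Gam hl)) (one_sub_re_le hl hX)) (weight_pos hX).le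

lemma integrableOn_omega1_re {l : ℂ} (hl : l ∈ Gam) :
    IntegrableOn (fun X : ℝ ↦ weight X * (1 / (1 - l / X) ^ (1 / 2 : ℂ)).re) (Ioi 1) := by
  have h := (integrableOn_omega1 hl).re
  simp only [RCLike.re_eq_complex_re, Complex.re_ofReal_mul] at h
  exact h

lemma omega1_re {l : ℂ} (hl : l ∈ Gam) :
    (omega1 l).re = ∫ X : ℝ in Ioi 1, weight X * (1 / (1 - l / X) ^ (1 / 2 : ℂ)).re := by
  have h := integral_re (integrableOn_omega1 hl)
  simp only [RCLike.re_eq_complex_re, Complex.re_ofReal_mul] at h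
  rw [omega1_eq, h]

lemma omega1_im {l : ℂ} (hl : l ∈ Gam) :
    (omega1 l).im = ∫ X : ℝ in Ioi 1, weight X * (1 / (1 - l / X) ^ (1 / 2 : ℂ)).im := by
  have h := integral_im (integrableOn_omega1 hl)
  simp only [RCLike.im_eq_complex_im, Complex.im_ofReal_mul] at h
  rw [omega1_eq, h]

/-- The argument of `X - l` is largest in modulus at `X = 1`, so that `ω₁` lies in the sector
`|arg| ≤ |arg (1 - l)| / 2`; the bound is the tangent of that angle. -/
lemma abs_im_omega1_le {l : ℂ} (hl : l ∈ Gam) :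
    |(omega1 l).im| ≤ |l.im| / (‖1 - l‖ + (1 - l.re)) * (omega1 l).re := by
  rw [omega1_im hl, omega1_re hl, ← integral_const_mul, ← Real.norm_eq_abs]
  refine norm_integral_le_of_norm_le ((integrableOn_omega1_re hl).const_mul _) ?_
  filter_upwards [ae_restrict_mem measurableSet_Ioi] with X hX
  have hX : 1 < X := hX
  have h0 : 0 < X := by linarith
  have ha := re_lt_one_of_mem_Gam hl
  have hz := re_one_sub_div_pos hl hX
  have h := abs_im_inv_cpow_half_mul hz
  have hu : 0 ≤ (1 / (1 - l / X) ^ (1 / 2 : ℂ)).re :=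
    le_trans (by positivity) (le_re_inv_cpow_half hz)
  have hw := weight_pos hX
  rw [im_one_sub_div, re_one_sub_div, norm_one_sub_div l h0, abs_neg, abs_div, abs_of_pos h0] at h
  set u := 1 / (1 - l / X) ^ (1 / 2 : ℂ)
  have h' : |u.im| * (‖X - l‖ + (X - l.re)) = |l.im| * u.re := by
    field_simp at h
    linarith
  have hmono : ‖1 - l‖ ≤ ‖X - l‖ := by
    rw [← sq_le_sq₀ (norm_nonneg _) (norm_nonneg _), Complex.sq_norm, Complex.sq_norm,
      Complex.normSq_apply, Complex.normSq_apply]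
    simp only [Complex.sub_re, Complex.one_re, Complex.sub_im, Complex.one_im, Complex.ofReal_re,
      Complex.ofReal_im]
    nlinarith
  have hd : 0 < ‖1 - l‖ + (1 - l.re) := by
    have := norm_nonneg (1 - l)
    linarith
  rw [norm_mul, Real.norm_of_nonneg hw.le, Real.norm_eq_abs, mul_left_comm]
  refine mul_le_mul_of_nonneg_left ?_ hw.le
  rw [div_mul_eq_mul_div, le_div_iff₀ hd, ← h']
  gcongr

/-- In the triangle with vertices `0`, `1`, `l` the angles `α`, `β` at `0` and `1` satisfy
`tan (α / 2) * tan (β / 2) = (p + q - 1) / (p + q + 1)`, where `p`, `q` are the sides other than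
`[0, 1]`; on the lens `p + q ≤ 2`. -/
lemma three_mul_im_sq_le {l : ℂ} (hl : l ∈ Gam) :
    3 * l.im ^ 2 ≤ (‖1 - l‖ + (1 - l.re)) * (‖l‖ + l.re) := by
  obtain ⟨-, -, hp, hq⟩ := hl
  have h1 : ‖l‖ ^ 2 = l.re ^ 2 + l.im ^ 2 := by
    rw [Complex.sq_norm, Complex.normSq_apply]; ring
  have h2 : ‖1 - l‖ ^ 2 = (1 - l.re) ^ 2 + l.im ^ 2 := by
    rw [Complex.sq_norm, Complex.normSq_apply]; simp; ring
  have hb1 : (‖1 - l‖ + (1 - l.re)) * (‖l‖ + l.re)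
      = (‖l‖ + ‖1 - l‖ + 1) ^ 2 * ((‖l‖ + 1 - ‖1 - l‖) * (‖1 - l‖ + 1 - ‖l‖)) / 4 := by
    have ha : l.re = (1 + ‖l‖ ^ 2 - ‖1 - l‖ ^ 2) / 2 := by linarith
    rw [ha]; ring
  -- Heron's formula
  have hb2 : l.im ^ 2 = (‖l‖ + ‖1 - l‖ + 1) * (‖l‖ + ‖1 - l‖ - 1)
      * ((‖l‖ + 1 - ‖1 - l‖) * (‖1 - l‖ + 1 - ‖l‖)) / 4 := by
    have ha : l.re = (1 + ‖l‖ ^ 2 - ‖1 - l‖ ^ 2) / 2 := by linarith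
    have hb : l.im ^ 2 = ‖l‖ ^ 2 - l.re ^ 2 := by linarith
    rw [hb, ha]; ring
  rw [hb1, hb2]
  have hp0 := norm_nonneg l
  have hq0 := norm_nonneg (1 - l)
  have hK : 0 ≤ (‖l‖ + 1 - ‖1 - l‖) * (‖1 - l‖ + 1 - ‖l‖) :=
    mul_nonneg (by linarith) (by linarith)
  have : 0 ≤ (‖l‖ + ‖1 - l‖ + 1) * (2 - ‖l‖ - ‖1 - l‖)
      * ((‖l‖ + 1 - ‖1 - l‖) * (‖1 - l‖ + 1 - ‖l‖)) :=
    mul_nonneg (mul_nonneg (by linarith) (by linarith)) hK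
  linarith

/-- The weight has mass `π`, and the other factor has real part at least `1 / √2` because
`‖1 - l / X‖ ≤ 1`. -/
lemma pi_div_sqrt_two_le_omega1_re {l : ℂ} (hl : l ∈ Gam) :
    Real.pi / √2 ≤ (omega1 l).re := by
  rw [omega1_re hl, ← integral_weight, ← integral_div]
  refine setIntegral_mono_on (integrableOn_weight.div_const _) (integrableOn_omega1_re hl)
    measurableSet_Ioi fun X hX ↦ ?_
  have hX : 1 < X := hX
  have h0 : 0 < X := by linarith
  have hz := re_one_sub_div_pos hl hX
  have hz0 : 0 < ‖1 - l / X‖ := hz.trans_le (Complex.re_le_norm _)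
  rw [div_eq_mul_one_div]
  refine mul_le_mul_of_nonneg_left (le_trans ?_ (le_re_inv_cpow_half hz)) (weight_pos hX).le
  have hn : ‖1 - l / X‖ ≤ 1 := by
    rw [norm_one_sub_div l h0, div_le_one h0, ← sq_le_sq₀ (norm_nonneg _) h0.le, Complex.sq_norm,
      Complex.normSq_apply]
    have h := normSq_le_two_mul_re hl
    have ha := re_pos_of_mem_Gam hl
    rw [Complex.sq_norm, Complex.normSq_apply] at h
    simp only [Complex.sub_re, Complex.sub_im, Complex.ofReal_re, Complex.ofReal_im]
    nlinarith
  refine one_div_le_one_div_of_le (by positivity) (Real.sqrt_le_sqrt (by linarith))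

/-- On `(1, 2]` the integrand of `Re ω₁` is at least `1 / (2 (X - 1 + ‖1 - l‖))`, whose integral
is `log ((1 + ‖1 - l‖) / ‖1 - l‖) / 2`. -/
lemma half_log_le_omega1_re {l : ℂ} (hl : l ∈ Gam) :
    Real.log ‖1 - l‖⁻¹ / 2 ≤ (omega1 l).re := by
  have hr : 0 < ‖1 - l‖ := norm_pos_iff.mpr (one_sub_mem_Gam hl).1
  set r := ‖1 - l‖ with hr_def
  clear_value r
  have hpos : ∀ X ∈ Ioi (1 : ℝ), 0 ≤ weight X * (1 / (1 - l / X) ^ (1 / 2 : ℂ)).re :=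
    fun X hX ↦ mul_nonneg (weight_pos hX).le
      (le_trans (by positivity) (le_re_inv_cpow_half (re_one_sub_div_pos hl hX)))
  have hderiv : ∀ X ∈ uIcc (1 : ℝ) 2,
      HasDerivAt (fun X ↦ Real.log (X - 1 + r) / 2) (1 / (X - 1 + r) / 2) X := by
    intro X hX
    rw [uIcc_of_le one_le_two] at hX
    have hne : X - 1 + r ≠ 0 := by linarith [hX.1]
    exact ((((hasDerivAt_id X).sub_const 1).add_const r).log hne).div_const 2
  have hcont : ContinuousOn (fun X : ℝ ↦ 1 / (X - 1 + r) / 2) (uIcc 1 2) := by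
    rw [uIcc_of_le one_le_two]
    refine (continuousOn_const.div (by fun_prop) fun X hX ↦ ?_).div_const 2
    linarith [hX.1]
  have hii := hcont.intervalIntegrable (μ := volume)
  have hFTC := intervalIntegral.integral_eq_sub_of_hasDerivAt hderiv hii
  rw [intervalIntegral.integral_of_le one_le_two] at hFTC
  calc Real.log r⁻¹ / 2 ≤ Real.log (2 - 1 + r) / 2 - Real.log (1 - 1 + r) / 2 := by
        rw [Real.log_inv, sub_self, zero_add]
        have : 0 ≤ Real.log (2 - 1 + r) := Real.log_nonneg (by linarith)
        rw [neg_div, ← zero_sub]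
        gcongr
        exact div_nonneg this zero_le_two
    _ = ∫ X in Ioc (1 : ℝ) 2, 1 / (X - 1 + r) / 2 := hFTC.symm
    _ ≤ ∫ X in Ioc (1 : ℝ) 2, weight X * (1 / (1 - l / X) ^ (1 / 2 : ℂ)).re := by
        refine setIntegral_mono_on ((intervalIntegrable_iff_integrableOn_Ioc_of_le one_le_two).mp
          hii) ((integrableOn_omega1_re hl).mono_set Ioc_subset_Ioi_self) measurableSet_Ioc ?_
        intro X hX
        have h1 : 0 < X - 1 := by linarith [hX.1]
        have h0 : 0 < X := by linarith
        have h2 : X ≤ 2 := hX.2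
        have hz := re_one_sub_div_pos hl hX.1
        have hz0 : 0 < ‖1 - l / X‖ := hz.trans_le (Complex.re_le_norm _)
        refine le_trans ?_ (mul_le_mul_of_nonneg_left (le_re_inv_cpow_half hz) (weight_pos hX.1).le)
        have hn : ‖(X : ℂ) - l‖ ≤ X - 1 + r := by
          calc ‖(X : ℂ) - l‖ = ‖((X - 1 : ℝ) : ℂ) + (1 - l)‖ := by push_cast; congr 1; ring
            _ ≤ ‖((X - 1 : ℝ) : ℂ)‖ + ‖1 - l‖ := norm_add_le _ _
            _ = X - 1 + r := by rw [hr_def, Complex.norm_real, Real.norm_of_nonneg h1.le]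
        rw [norm_one_sub_div l h0] at hz0 ⊢
        rw [weight, one_div_mul_one_div, div_div]
        refine one_div_le_one_div_of_le (by positivity) (le_of_sq_le_sq ?_ (by positivity))
        have hd : 0 ≤ ‖(X : ℂ) - l‖ := norm_nonneg _
        rw [mul_pow, mul_pow, Real.sq_sqrt h1.le, Real.sq_sqrt (by positivity)]
        calc X ^ 2 * (X - 1) * (2 * (‖(X : ℂ) - l‖ / X)) = 2 * X * ((X - 1) * ‖(X : ℂ) - l‖) := by
              field_simp
          _ ≤ 2 * 2 * ((X - 1 + r) * (X - 1 + r)) := by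
              gcongr
              linarith
          _ = ((X - 1 + r) * 2) ^ 2 := by ring
    _ ≤ ∫ X in Ioi (1 : ℝ), weight X * (1 / (1 - l / X) ^ (1 / 2 : ℂ)).re :=
        setIntegral_mono_set (integrableOn_omega1_re hl)
          ((ae_restrict_iff' measurableSet_Ioi).mpr (ae_of_all _ hpos))
          (Ioc_subset_Ioi_self.eventuallyLE)
    _ = (omega1 l).re := (omega1_re hl).symm

/-- With `ω₂ = i ω₁(1 - l)` the area is `-2 i Re (ω₁(l) * conj (ω₁(1 - l)))`. -/
lemma norm_area (l : ℂ) :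
    ‖area l‖ = 2 * |(omega1 l).re * (omega1 (1 - l)).re + (omega1 l).im * (omega1 (1 - l)).im| := by
  have h : area l = ((-2 * ((omega1 l).re * (omega1 (1 - l)).re
      + (omega1 l).im * (omega1 (1 - l)).im) : ℝ) : ℂ) * Complex.I := by
    rw [area, omega2_eq]
    apply Complex.ext <;> simp <;> ring
  rw [h, norm_mul, Complex.norm_I, mul_one, Complex.norm_real, Real.norm_eq_abs, abs_mul]
  norm_num

/-- The tangents of the sectors containing `ω₁(l)` and `ω₁(1 - l)` have product at most `1 / 3`,
so the imaginary parts cancel at most a third of the product of the real parts. -/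
lemma mul_re_le_norm_area {l : ℂ} (hl : l ∈ Gam) :
    4 / 3 * ((omega1 l).re * (omega1 (1 - l)).re) ≤ ‖area l‖ := by
  have hl' := one_sub_mem_Gam hl
  have i1 := abs_im_omega1_le hl
  have i2 := abs_im_omega1_le hl'
  have ht := three_mul_im_sq_le hl
  have hpi : 0 < Real.pi / √2 := by positivity
  have r1 := hpi.trans_le (pi_div_sqrt_two_le_omega1_re hl)
  have r2 := hpi.trans_le (pi_div_sqrt_two_le_omega1_re hl')
  simp only [sub_sub_cancel, Complex.sub_im, Complex.one_im, Complex.sub_re, Complex.one_re,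
    zero_sub, abs_neg] at i2
  have hd1 : 0 < ‖1 - l‖ + (1 - l.re) :=
    add_pos_of_nonneg_of_pos (norm_nonneg _) (sub_pos.mpr (re_lt_one_of_mem_Gam hl))
  have hd2 : 0 < ‖l‖ + l.re := add_pos_of_nonneg_of_pos (norm_nonneg _) (re_pos_of_mem_Gam hl)
  have hprod : |(omega1 l).im * (omega1 (1 - l)).im|
      ≤ 1 / 3 * ((omega1 l).re * (omega1 (1 - l)).re) := by
    calc |(omega1 l).im * (omega1 (1 - l)).im|
        = |(omega1 l).im| * |(omega1 (1 - l)).im| := abs_mul _ _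
      _ ≤ (|l.im| / (‖1 - l‖ + (1 - l.re)) * (omega1 l).re)
          * (|l.im| / (‖l‖ + l.re) * (omega1 (1 - l)).re) := by gcongr
      _ = l.im ^ 2 / ((‖1 - l‖ + (1 - l.re)) * (‖l‖ + l.re))
          * ((omega1 l).re * (omega1 (1 - l)).re) := by
          rw [← sq_abs l.im]
          field_simp
      _ ≤ 1 / 3 * ((omega1 l).re * (omega1 (1 - l)).re) := by
          refine mul_le_mul_of_nonneg_right ?_ (by positivity)
          rw [div_le_iff₀ (by positivity)]
          linarith
  have h1 := neg_abs_le ((omega1 l).im * (omega1 (1 - l)).im)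
  have h2 := le_abs_self ((omega1 l).re * (omega1 (1 - l)).re
    + (omega1 l).im * (omega1 (1 - l)).im)
  rw [norm_area]
  linarith

lemma log_bound_le_norm_area {l : ℂ} (hl : l ∈ Gam) :
    4 / Real.pi * (Real.log (max ‖l‖⁻¹ ‖1 - l‖⁻¹) - Real.log 11) ≤ ‖area l‖ := by
  have hl' := one_sub_mem_Gam hl
  have h := mul_re_le_norm_area hl
  have r1 := pi_div_sqrt_two_le_omega1_re hl
  have r2 := pi_div_sqrt_two_le_omega1_re hl'
  have l1 := half_log_le_omega1_re hl
  have l2 := half_log_le_omega1_re hl'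
  rw [sub_sub_cancel] at l2
  have hc : 2 ≤ Real.pi / √2 := by
    rw [le_div_iff₀ (by positivity)]
    nlinarith [Real.sq_sqrt (zero_le_two (α := ℝ)), Real.sqrt_nonneg 2, Real.pi_gt_three]
  have h11 : 0 ≤ Real.log 11 := Real.log_nonneg (by norm_num)
  have hpi : 4 / Real.pi ≤ 4 / 3 := by
    gcongr
    exact Real.pi_gt_three.le
  set L := Real.log (max ‖l‖⁻¹ ‖1 - l‖⁻¹) with hL
  have hL0 : 0 ≤ L := Real.log_nonneg
    (le_max_of_le_left ((one_le_inv₀ (norm_pos_iff.mpr hl.1)).mpr hl.2.2.1))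
  have hmain : L ≤ (omega1 l).re * (omega1 (1 - l)).re := by
    rcases max_choice ‖l‖⁻¹ ‖1 - l‖⁻¹ with hm | hm <;> rw [hm] at hL <;> nlinarith
  calc 4 / Real.pi * (L - Real.log 11) ≤ 4 / Real.pi * L := by gcongr; linarith
    _ ≤ 4 / 3 * L := by gcongr
    _ ≤ 4 / 3 * ((omega1 l).re * (omega1 (1 - l)).re) := by gcongr
    _ ≤ ‖area l‖ := h

lemma two_sqrt_three_le_norm_area {l : ℂ} (hl : l ∈ Gam) : 2 * √3 ≤ ‖area l‖ := by
  have r1 := pi_div_sqrt_two_le_omega1_re hl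
  have r2 := pi_div_sqrt_two_le_omega1_re (one_sub_mem_Gam hl)
  have hp : Real.pi / √2 * (Real.pi / √2) = Real.pi ^ 2 / 2 := by
    rw [div_mul_div_comm, Real.mul_self_sqrt zero_le_two, sq]
  have h3 : √3 ≤ 2 := by rw [Real.sqrt_le_left (by norm_num)]; norm_num
  have hpos : 0 < Real.pi / √2 := by positivity
  calc 2 * √3 ≤ 4 / 3 * (Real.pi ^ 2 / 2) := by nlinarith [Real.pi_gt_three]
    _ = 4 / 3 * (Real.pi / √2 * (Real.pi / √2)) := by rw [hp]
    _ ≤ 4 / 3 * ((omega1 l).re * (omega1 (1 - l)).re) := by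
        have := hpos.le.trans r1
        gcongr
    _ ≤ ‖area l‖ := mul_re_le_norm_area hl

lemma norm_lt_one_of_mem_interior_Gam {l : ℂ} (hl : l ∈ interior Gam) : ‖l‖ < 1 := by
  have hsub : Gam ⊆ Metric.closedBall 0 1 := fun x hx ↦ by simpa using hx.2.2.1
  simpa [interior_closedBall] using interior_mono hsub hl

lemma norm_one_sub_lt_one_of_mem_interior_Gam {l : ℂ} (hl : l ∈ interior Gam) :
    ‖1 - l‖ < 1 := by
  have hsub : Gam ⊆ Metric.closedBall 1 1 := fun x hx ↦ by
    simpa [dist_eq_norm, norm_sub_rev] using hx.2.2.2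
  simpa [interior_closedBall, dist_eq_norm, norm_sub_rev] using interior_mono hsub hl

end Legendre

theorem mainTheorem8 :
    (∀ l ∈ interior Legendre.Gam,
      Legendre.omega1 l = (Real.pi : ℂ) * Legendre.F l ∧
      Legendre.omega2 l = Complex.I * (Real.pi : ℂ) * Legendre.F (1 - l)) ∧
    (∀ l ∈ Legendre.Gam,
      max (4 / Real.pi * (Real.log (max ‖l‖⁻¹ ‖1 - l‖⁻¹) - Real.log 11)) (2 * Real.sqrt 3)
        ≤ ‖Legendre.area l‖) := by
  refine ⟨fun l hl ↦ ⟨?_, ?_⟩, fun l hl ↦ max_le ?_ ?_⟩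
  · exact Legendre.omega1_eq_pi_mul_F (Legendre.norm_lt_one_of_mem_interior_Gam hl)
  · rw [Legendre.omega2_eq, Legendre.omega1_eq_pi_mul_F
      (Legendre.norm_one_sub_lt_one_of_mem_interior_Gam hl), mul_assoc]
  · exact Legendre.log_bound_le_norm_area hl
  · exact Legendre.two_sqrt_three_le_norm_area hl
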